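/- Consider a synchronous network on a fixed set of $n$ nodes (with identifiers $1,\dots,n$) that starts as the empty graph $G_0$. At the beginning of each round $i\ge 1$ an arbitrary set of existing edges is deleted and then an arbitrary set of absent edges is inserted, which gives the graph $G_i$, and every node is notified of the deletions and insertions of its own edges. Then every node sends a message of $O(\log n)$ bits to each of its neighbors in $G_i$ (possibly different messages to different neighbors), and updates its local state from its previous state, the notifications and the received messages. In a deterministic distributed dynamic data structure for triangle membership listing, at the end of every round $i$ every node $v$ is, depending only on its local state, either in an inconsistent state or not; queried with any set $\{v,u,w\}$ of three distinct nodes, it responds without communication, from its local state only: it responds "inconsistent" if it is in an inconsistent state, and otherwise "true" if $\{v,u,w\}$ is a triangle of $G_i$ and "false" if it is not. The amortized round complexity is at most $k$ if, for every sequence of topology changes and every $i$, the number of rounds among $1,\dots,i$ at the end of which at least one node is in an inconsistent state is at most $k$ times the total number of edge insertions and deletions in the rounds $1,\dots,i$. **Theorem.** There is a deterministic distributed dynamic data structure for triangle membership listing which handles edge insertions and deletions in $O(1)$ amortized rounds. That is, there are absolute constants $c$ and $k$ such that for every $n$ there is such a data structure on $n$ nodes with messages of at most $c\lfloor\log_2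 n\rfloor$ bits and amortized round complexity at most $k$. -/

import Mathlib

namespace HighlyDynamic

/-- The evolution of a highly dynamic network on the `n` nodes `Fin n`.  It starts as the empty
graph; `graph r` is the communication graph `G_r` of round `r` (rounds are numbered `1, 2, …`).
At the beginning of round `r + 1` an arbitrary set `deleted (r + 1)` of existing edges is deleted,
and then an arbitrary set `inserted (r + 1)` of absent edges is inserted (so an edge may also be
deleted and inserted back in the same round).  Edge sets are represented as simple graphs. The
values `deleted 0` and `inserted 0` are not used. -/
structure Evolution (n : ℕ) where
  graph : ℕ → SimpleGraph (Fin n)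
  deleted : ℕ → SimpleGraph (Fin n)
  inserted : ℕ → SimpleGraph (Fin n)
  graph_zero : graph 0 = ⊥
  deleted_le : ∀ r, deleted (r + 1) ≤ graph r
  inserted_disjoint : ∀ r, Disjoint (inserted (r + 1)) (graph r \ deleted (r + 1))
  graph_succ : ∀ r, graph (r + 1) = (graph r \ deleted (r + 1)) ⊔ inserted (r + 1)

/-- The number of topology changes (over the whole network) in rounds `1, …, i`. -/
noncomputable def Evolution.changes {n : ℕ} (E : Evolution n) (i : ℕ) : ℕ :=
  ∑ r ∈ Finset.Icc 1 i, ((E.deleted r).edgeSet.ncard + (E.inserted r).edgeSet.ncard)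

/-- A message of at most `B` bits. The empty string also plays the role of sending nothing. -/
abbrev Message (B : ℕ) : Type := {m : List Bool // m.length ≤ B}

/-- The possible responses to a query. -/
inductive Response : Type
  | yes
  | no
  | inconsistent

/-- A deterministic distributed dynamic data structure on the `n` nodes `Fin n`, with messages of
at most `B` bits per link, direction and round, for queries that are sets of nodes and have a
yes/no answer.  Everything a node does is a function of its identifier and its local state. -/
structure DataStructure (n B : ℕ) where
  /-- the local states, that is, the possible values of the part `DS_v` at a node -/
  State : Type
  /-- the initial local state of a node -/
  init : Fin n → State
  /-- `react v D I s`: the new state of `v` when it is notified that precisely its edges to the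
  nodes in `D` were deleted and its edges to the nodes in `I` were inserted -/
  react : Fin n → Set (Fin n) → Set (Fin n) → State → State
  /-- `send v s u`: the message that `v` sends to its neighbor `u` -/
  send : Fin n → State → Fin n → Message B
  /-- `receive v m s`: the new state of `v` when it receives the message `m u` from each
  neighbor `u` (`m u = none` for the nodes `u` that are not neighbors) -/
  receive : Fin n → (Fin n → Option (Message B)) → State → State
  /-- whether the part at `v` is in an inconsistent state -/
  isInconsistent : Fin n → State → Bool
  /-- the answer of `v` to a query in a consistent state -/
  answer : Fin n → State → Finset (Fin n) → Bool

namespace DataStructure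

variable {n B : ℕ}

open Classical in
/-- `A.run E r v` is the state of `v` at the end of round `r` (the initial state for `r = 0`).
In each round every node reacts to the changes of its own edges, then messages are exchanged along
the edges of the current graph, and then every node updates its state. -/
noncomputable def run (A : DataStructure n B) (E : Evolution n) : ℕ → Fin n → A.State
  | 0 => A.init
  | r + 1 =>
    let mid : Fin n → A.State := fun v =>
      A.react v ((E.deleted (r + 1)).neighborSet v) ((E.inserted (r + 1)).neighborSet v)
        (A.run E r v)
    fun v =>
      A.receive v
        (fun u => if (E.graph (r + 1)).Adj u v then some (A.send u (mid u) v) else none)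
        (mid v)

/-- The part of the data structure at `v` is in an inconsistent state at the end of round `r`. -/
def InconsistentAt (A : DataStructure n B) (E : Evolution n) (r : ℕ) (v : Fin n) : Prop :=
  A.isInconsistent v (A.run E r v) = true

/-- The response of `v` to the query `q` at the end of round `r`, computed from its local state
without communication. -/
noncomputable def response (A : DataStructure n B) (E : Evolution n) (r : ℕ) (v : Fin n)
    (q : Finset (Fin n)) : Response :=
  if A.isInconsistent v (A.run E r v) = true then Response.inconsistent
  else if A.answer v (A.run E r v) q = true then Response.yes
  else Response.no

/-- Triangle membership listing: in every evolution, at the end of every round `r`, a node `v` that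
is queried with a set `{v, u, w}` of three nodes responds `inconsistent`, or `yes` if the set is a
triangle of `G_r`, or `no` if it is not. -/
def SolvesTriangleMembershipListing (A : DataStructure n B) : Prop :=
  ∀ (E : Evolution n) (r : ℕ) (v : Fin n) (q : Finset (Fin n)), v ∈ q → q.card = 3 →
    A.response E r v q = Response.inconsistent ∨
    (A.response E r v q = Response.yes ∧ (E.graph r).IsNClique 3 q) ∨
    (A.response E r v q = Response.no ∧ ¬ (E.graph r).IsNClique 3 q)

/-- The number of rounds among `1, …, i` at whose end some node is in an inconsistent state. -/
noncomputable def inconsistentRounds (A : DataStructure n B) (E : Evolution n) (i : ℕ) : ℕ :=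
  {r : ℕ | r ∈ Finset.Icc 1 i ∧ ∃ v, A.InconsistentAt E r v}.ncard

/-- The amortized round complexity is at most `k`: in every evolution and for every `i`, the number
of inconsistent rounds until round `i` is at most `k` times the number of topology changes until
round `i`. -/
def AmortizedRoundComplexityLE (A : DataStructure n B) (k : ℕ) : Prop :=
  ∀ (E : Evolution n) (i : ℕ), A.inconsistentRounds E i ≤ k * E.changes i

end DataStructure

end HighlyDynamic

namespace HighlyDynamic

namespace TriangleListing

open Classical

variable {n B : ℕ}

/-! Every node queues its changed incident edges and announces one per round, with its current
status, to all neighbors. When `v` announces `w`, this also asks each neighbor `u` about the edge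
`uw`; the answer arrives one round later. Why `v` then knows `uw`: if `vu` and `vw` exist when a
change of `uw` is announced by `u` or `w`, then `v` hears of it. If one of `vu`, `vw` is newer, `v`
itself announces it once both exist, and the node at the other edge answers about `uw`. Hence the
last report is right as soon as no such announcement or answer is outstanding (`mem_known_iff`), and
a consistent `v` can be sure of this (`not_pending`). Cost: the total queue length is a potential. A
change adds at most 2 to it, one per endpoint, and an inconsistent round lowers it by at least 1
(`inconsistentRounds_add_le`). -/

/-- The content of a message: a changed incident edge of the sender together with its current
status, the status of an incident edge about which the recipient has asked, and whether further
changes of the sender are still to be announced. Edges are given by their other endpoint. -/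
abbrev Content (n : ℕ) : Type := Option (Fin n × Bool) × Option (Fin n × Bool) × Bool

/-- The local state of a node. -/
structure LocalState (n : ℕ) where
  /-- the current neighbors -/
  nbrs : Set (Fin n)
  /-- the nodes to which the edge has changed and which are not yet announced -/
  dirty : Finset (Fin n)
  /-- the node announced in this round; the announcement is also the question to every neighbor
  whether it is adjacent to that node -/
  asked : Option (Fin n)
  /-- the nodes announced by the neighbors in this round -/
  queries : Fin n → Option (Fin n)
  /-- the pairs that were adjacent according to the last report about them -/
  known : Set (Sym2 (Fin n))
  /-- whether some neighbor has further changes to announce -/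
  waiting : Bool

namespace LocalState

/-- The node that is to be announced next. -/
noncomputable def next (s : LocalState n) : Option (Fin n) := s.dirty.toList.head?

/-- The nodes that remain to be announced after the next announcement. -/
noncomputable def rest (s : LocalState n) : Finset (Fin n) := s.dirty \ s.next.toFinset

/-- A node together with the status of the edge to it. -/
noncomputable def status (s : LocalState n) (w : Fin n) : Fin n × Bool := (w, decide (w ∈ s.nbrs))

/-- The state after a notification of changes. -/
noncomputable def notify (D I : Set (Fin n)) (s : LocalState n) : LocalState n :=
  { s with
    nbrs := (s.nbrs \ D) ∪ I
    dirty := s.dirty ∪ (D ∪ I).toFinset }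

/-- The message content for the neighbor `u`. -/
noncomputable def content (s : LocalState n) (u : Fin n) : Content n :=
  (s.next.map s.status, (s.queries u).map s.status, decide s.rest.Nonempty)

/-- The messages `m` report the status `b` of the edge `e`. -/
def Reports (m : Fin n → Option (Content n)) (e : Sym2 (Fin n)) (b : Bool) : Prop :=
  ∃ u c, m u = some c ∧ ∃ w, s(u, w) = e ∧ (c.1 = some (w, b) ∨ c.2.1 = some (w, b))

/-- The state after the messages of a round. -/
noncomputable def update (m : Fin n → Option (Content n)) (s : LocalState n) : LocalState n where
  nbrs := s.nbrs
  dirty := s.rest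
  asked := s.next
  queries u := (m u).bind fun c => c.1.map Prod.fst
  -- Actual reports of one round cannot conflict, as all describe the current graph. Pairs not
  -- reported keep their old, possibly stale, value.
  known := {e | if ∃ b, Reports m e b then Reports m e true else e ∈ s.known}
  waiting := decide (∃ u c, m u = some c ∧ c.2.2 = true)

theorem next_mem_dirty {s : LocalState n} {w : Fin n} (h : s.next = some w) : w ∈ s.dirty :=
  Finset.mem_toList.1 (List.mem_of_head? h)

theorem next_ne_none {s : LocalState n} (h : s.dirty.Nonempty) : s.next ≠ none := by
  simpa [next, List.head?_eq_none_iff] using h.ne_empty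

theorem mem_rest {s : LocalState n} {w : Fin n} :
    w ∈ s.rest ↔ w ∈ s.dirty ∧ s.next ≠ some w := by
  simp [rest]

theorem card_rest_lt {s : LocalState n} (h : s.dirty.Nonempty) : s.rest.card < s.dirty.card := by
  obtain ⟨w, hw⟩ := Option.ne_none_iff_exists'.1 (next_ne_none h)
  refine Finset.card_lt_card ⟨Finset.sdiff_subset, fun h' => ?_⟩
  exact (mem_rest.1 (h' (next_mem_dirty hw))).2 hw

end LocalState

open LocalState

/-- The data structure in which every node announces its changed edges one by one, and answers the
announcement of a node by telling whether it is adjacent to that node. -/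
noncomputable def dataStructure (enc : Content n → Message B) (dec : Message B → Content n) :
    DataStructure n B where
  State := LocalState n
  init _ := ⟨∅, ∅, none, fun _ => none, ∅, false⟩
  react _ D I s := s.notify D I
  send _ s u := enc (s.content u)
  receive _ m s := s.update fun u => (m u).map dec
  isInconsistent _ s := decide (s.dirty.Nonempty ∨ s.asked ≠ none ∨ s.waiting = true)
  answer v s q := decide (∃ u w, q = {v, u, w} ∧ u ∈ s.nbrs ∧ w ∈ s.nbrs ∧ s(u, w) ∈ s.known)

/-! ### Execution: local views and reports -/

section Execution

variable (enc : Content n → Message B) (dec : Message B → Content n) (E : Evolution n)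

/-- The state at the end of a round. -/
noncomputable def final (r : ℕ) (v : Fin n) : LocalState n := (dataStructure enc dec).run E r v

/-- The state in round `r + 1` between the notification and the messages. -/
noncomputable def middle (r : ℕ) (v : Fin n) : LocalState n :=
  (final enc dec E r v).notify ((E.deleted (r + 1)).neighborSet v)
    ((E.inserted (r + 1)).neighborSet v)

/-- The message contents that `v` receives in round `r + 1`. -/
noncomputable def inbox (r : ℕ) (v u : Fin n) : Option (Content n) :=
  if (E.graph (r + 1)).Adj u v then some ((middle enc dec E r u).content v) else none

variable {enc dec} (hdec : ∀ c, dec (enc c) = c)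

include hdec in
theorem final_succ (r : ℕ) (v : Fin n) :
    final enc dec E (r + 1) v = (middle enc dec E r v).update (inbox enc dec E r v) := by
  change LocalState.update (fun u => Option.map dec
    (if (E.graph (r + 1)).Adj u v then some (enc ((middle enc dec E r u).content v)) else none))
    (middle enc dec E r v) = _
  congr 1
  funext u
  unfold inbox
  split_ifs <;> simp [hdec]

include hdec in
theorem nbrs_final (r : ℕ) (v : Fin n) :
    (final enc dec E r v).nbrs = (E.graph r).neighborSet v := by
  induction r with
  | zero =>
    ext u
    simp [final, DataStructure.run, dataStructure, E.graph_zero]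
  | succ r ih =>
    rw [final_succ E hdec]
    ext u
    simp [update, middle, notify, ih, E.graph_succ]

include hdec in
theorem mem_nbrs_middle (r : ℕ) (v u : Fin n) :
    u ∈ (middle enc dec E r v).nbrs ↔ (E.graph (r + 1)).Adj v u := by
  have := nbrs_final E hdec (r + 1) v
  rw [final_succ E hdec] at this
  exact Set.ext_iff.1 this u

theorem mem_dirty_middle {r : ℕ} {v u : Fin n} :
    u ∈ (middle enc dec E r v).dirty ↔ u ∈ (final enc dec E r v).dirty ∨
      (E.deleted (r + 1)).Adj v u ∨ (E.inserted (r + 1)).Adj v u := by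
  simp [middle, notify]

theorem adj_succ_iff_of_notMem_dirty {r : ℕ} {v u : Fin n}
    (h : u ∉ (middle enc dec E r v).dirty) :
    (E.graph (r + 1)).Adj v u ↔ (E.graph r).Adj v u := by
  rw [mem_dirty_middle] at h
  push Not at h
  simp [E.graph_succ, h.2.1, h.2.2]

include hdec in
/-- Every report is about the current graph. -/
theorem reports_inbox {r : ℕ} {v x y : Fin n} {b : Bool}
    (h : Reports (inbox enc dec E r v) s(x, y) b) : b = true ↔ (E.graph (r + 1)).Adj x y := by
  obtain ⟨u, c, hc, w, he, hw⟩ := h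
  have hb : b = true ↔ (E.graph (r + 1)).Adj u w := by
    rw [← mem_nbrs_middle E hdec]
    unfold inbox at hc
    split_ifs at hc with hadj
    obtain rfl := Option.some.inj hc
    simp only [content, Option.map_eq_some_iff, status, Prod.mk.injEq] at hw
    rcases hw with ⟨_, _, rfl, rfl⟩ | ⟨_, _, rfl, rfl⟩ <;> simp
  rw [hb, ← SimpleGraph.mem_edgeSet, ← SimpleGraph.mem_edgeSet, he]

include hdec in
theorem mem_known_of_reports {r : ℕ} {v x y : Fin n} {b : Bool}
    (h : Reports (inbox enc dec E r v) s(x, y) b) :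
    s(x, y) ∈ (final enc dec E (r + 1) v).known ↔ (E.graph (r + 1)).Adj x y := by
  have hex : ∃ b, Reports (inbox enc dec E r v) s(x, y) b := ⟨b, h⟩
  simp only [final_succ E hdec, update, Set.mem_ofPred_eq, if_pos hex]
  refine ⟨fun h' => (reports_inbox E hdec h').1 rfl, fun hadj => ?_⟩
  rwa [(reports_inbox E hdec h).2 hadj] at h

/-- An announcement is a report to every neighbor. -/
theorem reports_of_next {r : ℕ} {v u w : Fin n} (huv : (E.graph (r + 1)).Adj v u)
    (h : (middle enc dec E r u).next = some w) :
    ∃ b, Reports (inbox enc dec E r v) s(u, w) b :=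
  ⟨_, u, _, if_pos huv.symm, w, rfl, Or.inl (by simp only [content, h]; rfl)⟩

include hdec in
/-- A question is answered in the next round. -/
theorem reports_of_asked {r : ℕ} {v u w : Fin n} (hold : (E.graph r).Adj v u)
    (huv : (E.graph (r + 1)).Adj v u) (h : (final enc dec E r v).asked = some w) :
    ∃ b, Reports (inbox enc dec E r v) s(u, w) b := by
  -- `hold` guarantees that the question reached `u` in the previous round.
  have hq : (middle enc dec E r u).queries v = some w := by
    change (final enc dec E r u).queries v = some w
    cases r with
    | zero => simp [E.graph_zero] at hold
    | succ r =>
      rw [final_succ E hdec] at h ⊢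
      have h' : (middle enc dec E r v).next = some w := h
      simp [update, inbox, hold, content, h', status]
  exact ⟨_, u, _, if_pos huv.symm, w, rfl, Or.inr (by simp only [content, hq]; rfl)⟩

/-! ### Correctness of the answers -/

/-- The edge between `u` and `w` may be unknown to their common neighbor `v`, because one of the
three nodes has not yet announced an edge between them or because `v` waits for an answer. -/
def Pending (r : ℕ) (v u w : Fin n) (enc : Content n → Message B) (dec : Message B → Content n) :
    Prop :=
  w ∈ (final enc dec E r u).dirty ∨ u ∈ (final enc dec E r w).dirty ∨
    u ∈ (final enc dec E r v).dirty ∨ w ∈ (final enc dec E r v).dirty ∨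
    (final enc dec E r v).asked = some u ∨ (final enc dec E r v).asked = some w

include hdec in
-- A report in the current round settles the claim. Without one, none of the edges `uw`, `vu`, `vw`
-- changed in this round and nothing was pending before, so the claim carries over from the previous
-- round.
theorem mem_known_iff (r : ℕ) (v u w : Fin n) (hu : (E.graph r).Adj v u)
    (hw : (E.graph r).Adj v w) (hp : ¬ Pending E r v u w enc dec) :
    s(u, w) ∈ (final enc dec E r v).known ↔ (E.graph r).Adj u w := by
  induction r with
  | zero => simp [E.graph_zero] at hu
  | succ r ih =>
    by_cases hex : ∃ b, Reports (inbox enc dec E r v) s(u, w) b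
    · exact mem_known_of_reports E hdec hex.choose_spec
    have hex' : ¬ ∃ b, Reports (inbox enc dec E r v) s(w, u) b := by rwa [Sym2.eq_swap]
    simp only [Pending, final_succ E hdec, update, mem_rest] at hp
    push Not at hp
    obtain ⟨huw, hwu, hvu, hvw, hau, haw⟩ := hp
    -- An entry queued before the messages but absent afterwards was announced in this round. By `u`
    -- or `w` this would be a report; by `v` it would set `asked`.
    have huw : w ∉ (middle enc dec E r u).dirty := fun h => hex (reports_of_next E hu (huw h))
    have hwu : u ∉ (middle enc dec E r w).dirty := fun h => hex' (reports_of_next E hw (hwu h))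
    have hvu : u ∉ (middle enc dec E r v).dirty := fun h => hau (hvu h)
    have hvw : w ∉ (middle enc dec E r v).dirty := fun h => haw (hvw h)
    have hu' := (adj_succ_iff_of_notMem_dirty E hvu).1 hu
    have hw' := (adj_succ_iff_of_notMem_dirty E hvw).1 hw
    have key : s(u, w) ∈ (final enc dec E (r + 1) v).known ↔
        s(u, w) ∈ (final enc dec E r v).known := by
      simp only [final_succ E hdec, update, Set.mem_ofPred_eq, if_neg hex]
      rfl
    rw [key, adj_succ_iff_of_notMem_dirty E huw]
    refine ih hu' hw' ?_
    rw [mem_dirty_middle] at huw hwu hvu hvw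
    rintro (h | h | h | h | h | h)
    · exact huw (Or.inl h)
    · exact hwu (Or.inl h)
    · exact hvu (Or.inl h)
    · exact hvw (Or.inl h)
    -- An earlier question of `v` about one of `u`, `w` would be answered now by the other.
    · exact hex' (reports_of_asked E hdec hw' hw h)
    · exact hex (reports_of_asked E hdec hu' hu h)

include hdec in
-- The flag sent by a neighbor is about its `rest`, which is exactly its queue at the end of the
-- round, so `waiting` is up to date.
theorem not_pending {r : ℕ} {v u w : Fin n} (hu : (E.graph r).Adj v u) (hw : (E.graph r).Adj v w)
    (h : ¬ (dataStructure enc dec).InconsistentAt E r v) : ¬ Pending E r v u w enc dec := by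
  cases r with
  | zero => simp [E.graph_zero] at hu
  | succ r =>
    have h' : ¬ ((final enc dec E (r + 1) v).dirty.Nonempty ∨
        (final enc dec E (r + 1) v).asked ≠ none ∨
        (final enc dec E (r + 1) v).waiting = true) :=
      fun h' => h (decide_eq_true h')
    push Not at h'
    obtain ⟨hd, ha, hwait⟩ := h'
    have hnbr : ∀ x, (E.graph (r + 1)).Adj v x → (final enc dec E (r + 1) x).dirty = ∅ := by
      intro x hx
      by_contra hne
      rw [final_succ E hdec] at hne hwait
      refine hwait (decide_eq_true ⟨x, _, if_pos hx.symm, decide_eq_true ?_⟩)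
      exact Finset.nonempty_iff_ne_empty.2 hne
    simp [Pending, hd, ha, hnbr u hu, hnbr w hw]

include hdec in
theorem solves : (dataStructure enc dec).SolvesTriangleMembershipListing := by
  intro E r v q hv hq
  by_cases hinc : (dataStructure enc dec).InconsistentAt E r v
  · exact Or.inl (if_pos hinc)
  have hans : (dataStructure enc dec).answer v ((dataStructure enc dec).run E r v) q = true ↔
      (E.graph r).IsNClique 3 q := by
    change decide (∃ u w, q = {v, u, w} ∧ u ∈ (final enc dec E r v).nbrs ∧
      w ∈ (final enc dec E r v).nbrs ∧ s(u, w) ∈ (final enc dec E r v).known) = true ↔ _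
    rw [decide_eq_true_iff, nbrs_final E hdec]
    simp only [SimpleGraph.mem_neighborSet]
    constructor
    · rintro ⟨u, w, rfl, hu, hw, hk⟩
      rw [mem_known_iff E hdec r v u w hu hw (not_pending E hdec hu hw hinc)] at hk
      exact SimpleGraph.is3Clique_triple_iff.2 ⟨hu, hw, hk⟩
    · intro hc
      obtain ⟨u, w, huw, he⟩ := Finset.card_eq_two.1
        (show (q.erase v).card = 2 by rw [Finset.card_erase_of_mem hv, hq])
      have hq' : q = {v, u, w} := by rw [← Finset.insert_erase hv, he]
      rw [hq', SimpleGraph.is3Clique_triple_iff] at hc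
      obtain ⟨hu, hw, hadj⟩ := hc
      exact ⟨u, w, hq', hu, hw,
        (mem_known_iff E hdec r v u w hu hw (not_pending E hdec hu hw hinc)).2 hadj⟩
  have hresp : (dataStructure enc dec).response E r v q =
      if (dataStructure enc dec).answer v ((dataStructure enc dec).run E r v) q = true
        then Response.yes else Response.no := if_neg hinc
  rw [hresp]
  by_cases hc : (E.graph r).IsNClique 3 q
  · exact Or.inr (Or.inl ⟨if_pos (hans.2 hc), hc⟩)
  · exact Or.inr (Or.inr ⟨if_neg fun h => hc (hans.1 h), hc⟩)

/-! ### Amortized round complexity -/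

theorem sum_card_neighborSet (G : SimpleGraph (Fin n)) :
    ∑ v, (G.neighborSet v).toFinset.card = 2 * G.edgeSet.ncard := by
  rw [Set.ncard_eq_toFinset_card', ← SimpleGraph.edgeFinset, ← G.sum_degrees_eq_twice_card_edges]
  refine Finset.sum_congr rfl fun v _ => ?_
  rw [← SimpleGraph.card_neighborFinset_eq_degree, SimpleGraph.neighborFinset]

theorem sum_card_dirty_middle_le (r : ℕ) :
    ∑ v, (middle enc dec E r v).dirty.card ≤ ∑ v, (final enc dec E r v).dirty.card +
      2 * ((E.deleted (r + 1)).edgeSet.ncard + (E.inserted (r + 1)).edgeSet.ncard) := by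
  rw [mul_add, ← sum_card_neighborSet, ← sum_card_neighborSet, ← Finset.sum_add_distrib,
    ← Finset.sum_add_distrib]
  refine Finset.sum_le_sum fun v _ => (Finset.card_union_le _ _).trans ?_
  rw [Set.toFinset_union]
  exact Nat.add_le_add_left (Finset.card_union_le _ _) _

include hdec in
-- Each cause of inconsistency traces back to a nonempty queue before the messages, at `v` or, for
-- `waiting`, at a neighbor. That queue shrinks in this round.
theorem exists_dirty_of_inconsistentAt {r : ℕ} {v : Fin n}
    (h : (dataStructure enc dec).InconsistentAt E (r + 1) v) :
    ∃ u, (middle enc dec E r u).dirty.Nonempty := by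
  have h' : (final enc dec E (r + 1) v).dirty.Nonempty ∨
      (final enc dec E (r + 1) v).asked ≠ none ∨
      (final enc dec E (r + 1) v).waiting = true := of_decide_eq_true h
  rw [final_succ E hdec] at h'
  rcases h' with h' | h' | h'
  · exact ⟨v, h'.mono Finset.sdiff_subset⟩
  · obtain ⟨w, hw⟩ := Option.ne_none_iff_exists'.1 h'
    exact ⟨v, w, next_mem_dirty hw⟩
  · obtain ⟨u, c, hc, hb⟩ := of_decide_eq_true h'
    unfold inbox at hc
    split_ifs at hc
    obtain rfl := Option.some.inj hc
    exact ⟨u, (of_decide_eq_true hb).mono Finset.sdiff_subset⟩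

include hdec in
theorem sum_card_dirty_succ_add_le (r : ℕ) :
    ∑ v, (final enc dec E (r + 1) v).dirty.card +
      (if ∃ v, (dataStructure enc dec).InconsistentAt E (r + 1) v then 1 else 0) ≤
      ∑ v, (middle enc dec E r v).dirty.card := by
  have hle : ∀ v, (final enc dec E (r + 1) v).dirty.card ≤ (middle enc dec E r v).dirty.card := by
    intro v
    rw [final_succ E hdec]
    exact Finset.card_le_card Finset.sdiff_subset
  split_ifs with h
  · obtain ⟨v, hv⟩ := h
    obtain ⟨u, hu⟩ := exists_dirty_of_inconsistentAt E hdec hv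
    refine Finset.sum_lt_sum (fun v _ => hle v) ⟨u, Finset.mem_univ u, ?_⟩
    rw [final_succ E hdec]
    exact card_rest_lt hu
  · rw [add_zero]
    exact Finset.sum_le_sum fun v _ => hle v

include hdec in
theorem inconsistentRounds_add_le (i : ℕ) :
    (dataStructure enc dec).inconsistentRounds E i + ∑ v, (final enc dec E i v).dirty.card ≤
      2 * E.changes i := by
  have hcard : ∀ i, (dataStructure enc dec).inconsistentRounds E i =
      ∑ r ∈ Finset.Icc 1 i,
        if ∃ v, (dataStructure enc dec).InconsistentAt E r v then 1 else 0 := by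
    intro i
    rw [← Finset.card_filter, ← Set.ncard_coe_finset, Finset.coe_filter]
    rfl
  induction i with
  | zero =>
    rw [hcard]
    simp [final, DataStructure.run, dataStructure]
  | succ i ih =>
    have h1 := sum_card_dirty_succ_add_le E hdec i
    have h2 := sum_card_dirty_middle_le (enc := enc) (dec := dec) E i
    unfold Evolution.changes at ih ⊢
    rw [hcard] at ih ⊢
    rw [Finset.sum_Icc_succ_top (by omega), Finset.sum_Icc_succ_top (by omega)]
    omega

end Execution

/-! ### Message length -/

/-- Messages of `9 * log n` bits suffice for the contents. -/
theorem exists_encoding (hn : 2 ≤ n) :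
    ∃ (enc : Content n → Message (9 * Nat.log 2 n)) (dec : Message (9 * Nat.log 2 n) → Content n),
      ∀ c, dec (enc c) = c := by
  set L := Nat.log 2 n with hL
  have hL1 : 1 ≤ L := Nat.log_pos (by norm_num) hn
  have hnL : n < 2 ^ (L + 1) := Nat.lt_pow_succ_log_self (by norm_num) n
  have hcard : Fintype.card (Content n) ≤ Fintype.card (List.Vector Bool (9 * L)) := by
    have h1 : n * 2 + 1 ≤ 2 ^ (L + 3) := by
      rw [pow_add] at hnL ⊢
      omega
    calc Fintype.card (Content n) = (n * 2 + 1) * ((n * 2 + 1) * 2) := by simp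
      _ ≤ 2 ^ (L + 3) * (2 ^ (L + 3) * 2) := by gcongr
      _ = 2 ^ (2 * L + 7) := by ring
      -- The constant 9 absorbs the additive 7, because `L ≥ 1`.
      _ ≤ 2 ^ (9 * L) := Nat.pow_le_pow_right (by norm_num) (by omega)
      _ = Fintype.card (List.Vector Bool (9 * L)) := by simp
  obtain ⟨f⟩ := Function.Embedding.nonempty_of_card_le hcard
  have hinj : Function.Injective
      (fun c => (⟨(f c).1, (f c).2.le⟩ : Message (9 * L))) := by
    intro a b hab
    have hval : (f a).1 = (f b).1 := congrArg (fun m : Message (9 * L) => m.1) hab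
    exact f.injective (Subtype.ext hval)
  have : Nonempty (Content n) := ⟨(none, none, false)⟩
  exact ⟨_, Function.invFun _, Function.leftInverse_invFun hinj⟩

end TriangleListing

end HighlyDynamic

open HighlyDynamic TriangleListing in
/-- There are absolute constants `c` and `k` such that, for every `n`, some deterministic
distributed dynamic data structure on `n` nodes with messages of at most `c * log n` bits solves
triangle membership listing with amortized round complexity at most `k`. -/
theorem theorem1 :
    ∃ c k : ℕ, ∀ n : ℕ, ∃ A : HighlyDynamic.DataStructure n (c * Nat.log 2 n),
      A.SolvesTriangleMembershipListing ∧ A.AmortizedRoundComplexityLE k := by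
  refine ⟨9, 2, fun n => ?_⟩
  rcases le_or_gt 2 n with hn | hn
  · obtain ⟨enc, dec, hdec⟩ := exists_encoding hn
    exact ⟨dataStructure enc dec, solves hdec, fun E i =>
      (Nat.le_add_right _ _).trans (inconsistentRounds_add_le E hdec i)⟩
  -- For `n ≤ 1` no bits are available, but there are no three distinct nodes to query either.
  · refine ⟨⟨Unit, fun _ => (), fun _ _ _ _ => (), fun _ _ _ => ⟨[], Nat.zero_le _⟩,
      fun _ _ _ => (), fun _ _ => false, fun _ _ _ => false⟩, fun E r v q _ hq => ?_,
      fun E i => ?_⟩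
    · have := q.card_le_univ
      rw [hq, Fintype.card_fin] at this
      omega
    · simp [DataStructure.inconsistentRounds, DataStructure.InconsistentAt]
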